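/- **Conventions.** A (right) near-ring is a set $N$ with operations $+,\cdot$ such that $(N,+)$ is a group (not necessarily abelian), $(N,\cdot)$ is a semigroup and $(a+b)c=ac+bc$ for all $a,b,c\in N$. It is zero-symmetric if $n0=0$ for all $n\in N$, and it is a ring if moreover $(N,+)$ is abelian and $a(b+c)=ab+ac$ for all $a,b,c$. An $N$-group is a group $(\Gamma,+)$ with a map $N\times\Gamma\to\Gamma$, $(n,\gamma)\mapsto n\gamma$, such that $(m+n)\gamma=m\gamma+n\gamma$ and $(mn)\gamma=m(n\gamma)$. An $N$-ideal of $\Gamma$ is a normal subgroup $I$ with $n(\gamma+i)-n\gamma\in I$ for all $n\in N$, $\gamma\in\Gamma$, $i\in I$. The $N$-group $\Gamma$ is of type $1$ if $\Gamma\neq\{0\}$, its only $N$-ideals are $\{0\}$ and $\Gamma$, there is $\gamma\in\Gamma$ with $N\gamma=\Gamma$, and for every $\gamma\in\Gamma$ either $N\gamma=\Gamma$ or $N\gamma=\{0\}$. It is faithful if $n\Gamma=\{0\}$ implies $n=0$. $N$ is $1$-primitive if it has a faithful $N$-group of type $1$. Let $(\Gamma,+)$ be a group, $X\subseteq\Gamma$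 with $0\in X$, $S\le\mathrm{Aut}(\Gamma,+)$ with $S(X)\subseteq X$, and $\phi:\Gamma\to X$ with $\phi(0)=0$ and $\phi(s(\gamma))=s(\phi(\gamma))$ for all $s\in S$, $\gamma\in\Gamma$. The sandwich centralizer near-ring is $$M_0(X,\Gamma,\phi,S)=\{f:X\to\Gamma\mid f(0)=0,\ f(s(x))=s(f(x))\ \text{for all } s\in S,\ x\in X\}$$ with pointwise addition and multiplication $f\circ' g=f\circ\phi\circ g$. A subnear-ring $F$ of it (an additive subgroup closed under $\circ'$) is dense if for all finitely many $x_1,\dots,x_l\in X$ and all $g\in M_0(X,\Gamma,\phi,S)$ there is $f\in F$ with $f(x_i)=g(x_i)$ for $i=1,\dots,l$. **Theorem.** Let $N$ be a zero-symmetric near-ring which is not a ring. Then the following are equivalent: 1. $N$ is $1$-primitive. 2. There exist (a) a group $(\Gamma,+)$, (b) a set $X=\{0\}\cup X_1\subseteq\Gamma$ with $X_1\neq\emptyset$ and $0\notin X_1$, (c) a group $S\le\mathrm{Aut}(\Gamma,+)$ with $S(X)\subseteq X$, acting without fixed points on $X_1$ (that is, $s\in S$, $x\in X_1$ and $s(x)=x$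 imply $s=\mathrm{id}$), (d) a function $\phi:\Gamma\to X$ with $\phi|_X=\mathrm{id}$, $\phi(0)=0$ and $\phi(s(\gamma))=s(\phi(\gamma))$ for all $\gamma\in\Gamma$, $s\in S$, such that $N$ is isomorphic to a dense subnear-ring $M_S$ of $M_0(X,\Gamma,\phi,S)$ and the following property (P) holds. Put $\Gamma_0=\{\gamma\in\Gamma\mid\phi(\gamma)=0\}$, write $S(\gamma)=\{s(\gamma)\mid s\in S\}$, and let $C$ be the set of all normal subgroups $I$ of $\Gamma$ such that $I\subseteq\Gamma_0$, $\Gamma_0=\bigcup_{\delta\in\Gamma_0}(\delta+I)$, and $S(\phi(\gamma+i))=S(\phi(\gamma))$ for all $\gamma\in\Gamma\setminus\Gamma_0$ and $i\in I$. Then (P): for every $I\in C$, either $I=\{0\}$ or there exist $i\in I$, $\gamma_1\in\Gamma\setminus\Gamma_0$, $s\in S$ and $\gamma\in\Gamma$ such that $\phi(\gamma_1+i)=s(\phi(\gamma_1))$ and $s(\gamma)-\gamma\notin I$. -/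

import Mathlib

universe u v

/-! ### Near-rings and their groups -/

/-- A (right) near-ring: `(N, +)` is a group, not necessarily abelian, `(N, *)` is a semigroup,
and `(a + b) * c = a * c + b * c`. -/
class NearRing (N : Type u) extends AddGroup N, Semigroup N where
  right_distrib : ∀ a b c : N, (a + b) * c = a * c + b * c

/-- A near-ring is zero-symmetric if `n * 0 = 0` for all `n`
(the equation `0 * n = 0` holds in every right near-ring). -/
def IsZeroSymmetric (N : Type u) [NearRing N] : Prop :=
  ∀ n : N, n * 0 = 0

/-- A near-ring is a ring (associative, not necessarily unital) if its addition is commutative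
and the left distributive law holds as well. -/
def IsRingNearRing (N : Type u) [NearRing N] : Prop :=
  (∀ a b : N, a + b = b + a) ∧ ∀ a b c : N, a * (b + c) = a * b + a * c

/-- An `N`-group: a group `Γ`, not necessarily abelian, with an action of `N` such that
`(m + n)γ = mγ + nγ` and `(mn)γ = m(nγ)`. -/
class NGroup (N : Type u) (Γ : Type v) [NearRing N] [AddGroup Γ] extends SMul N Γ where
  add_smul : ∀ (m n : N) (γ : Γ), (m + n) • γ = m • γ + n • γ
  mul_smul : ∀ (m n : N) (γ : Γ), (m * n) • γ = m • (n • γ)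

namespace NGroup

variable (N : Type u) (Γ : Type v) [NearRing N] [AddGroup Γ] [NGroup N Γ]

/-- An `N`-ideal: a normal subgroup `I` with `n(γ + i) - nγ ∈ I` for all `n`, `γ` and `i ∈ I`. -/
def IsIdeal {Γ : Type v} [AddGroup Γ] [NGroup N Γ] (I : AddSubgroup Γ) : Prop :=
  I.Normal ∧ ∀ (n : N) (γ : Γ), ∀ i ∈ I, n • (γ + i) - n • γ ∈ I

/-- `γ` is a generator: `Nγ = Γ`. -/
def IsGenerator {Γ : Type v} [AddGroup Γ] [NGroup N Γ] (γ : Γ) : Prop :=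
  Set.range (fun n : N => n • γ) = Set.univ

/-- Type `0`: `Γ ≠ {0}`, the only `N`-ideals are `{0}` and `Γ`, and there is a generator. -/
def IsType0 : Prop :=
  Nontrivial Γ ∧ (∀ I : AddSubgroup Γ, IsIdeal N I → I = ⊥ ∨ I = ⊤) ∧ ∃ γ : Γ, IsGenerator N γ

/-- Type `1`: type `0`, and `Nγ = Γ` or `Nγ = {0}` for every `γ`. -/
def IsType1 : Prop :=
  IsType0 N Γ ∧ ∀ γ : Γ, IsGenerator N γ ∨ Set.range (fun n : N => n • γ) = {0}

/-- `Γ` is faithful: the annihilator `(0 : Γ)` is zero. -/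
def IsFaithful : Prop :=
  {n : N | ∀ γ : Γ, n • γ = 0} = {0}

end NGroup

/-- `N` is `1`-primitive if it has a faithful `N`-group of type `1`. (Since such a group is of the
form `Nγ`, it is no restriction to look for it in the universe of `N`.) -/
def IsOnePrimitive (N : Type u) [NearRing N] : Prop :=
  ∃ (Γ : Type u) (_ : AddGroup Γ) (_ : NGroup N Γ), NGroup.IsType1 N Γ ∧ NGroup.IsFaithful N Γ

/-- A subnear-ring: a subgroup of the additive group that is closed under multiplication. -/
structure SubNearRing (N : Type u) [NearRing N] extends AddSubgroup N where
  mul_mem' : ∀ {a b : N}, a ∈ carrier → b ∈ carrier → a * b ∈ carrier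

namespace SubNearRing

variable {N : Type u} [NearRing N]

/-- The type of elements of a subnear-ring. -/
def Elem (F : SubNearRing N) : Type u := F.toAddSubgroup

instance (F : SubNearRing N) : NearRing F.Elem :=
  { (inferInstance : AddGroup F.toAddSubgroup) with
    mul := fun a b => ⟨a.1 * b.1, F.mul_mem' a.2 b.2⟩
    mul_assoc := fun a b c => Subtype.ext (mul_assoc a.1 b.1 c.1)
    right_distrib := fun a b c => Subtype.ext (NearRing.right_distrib a.1 b.1 c.1) }

end SubNearRing

/-! ### Sandwich centralizer near-rings -/

/-- The data `(X, φ, S)` on a group `Γ` from which a sandwich centralizer near-ring is built: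
a subset `X` containing `0`, a map `φ : Γ → X` with `φ(0) = 0`, and a group `S` of automorphisms
of `Γ` with `S(X) ⊆ X` and `φ(s(γ)) = s(φ(γ))`. (Mathlib writes the group `AddAut Γ` of
automorphisms of `Γ`, with composition as its operation, additively.) -/
structure SandwichData (Γ : Type u) [AddGroup Γ] where
  X : Set Γ
  zero_mem : (0 : Γ) ∈ X
  φ : Γ → X
  φ_zero : (φ 0 : Γ) = 0
  S : AddSubgroup (AddAut Γ)
  map_mem : ∀ s ∈ S, ∀ x ∈ X, s x ∈ X
  equivariant : ∀ s ∈ S, ∀ γ : Γ, (φ (s γ) : Γ) = s (φ γ)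

namespace SandwichData

variable {Γ : Type u} [AddGroup Γ] (D : SandwichData Γ)

/-- The additive group of all `f : X → Γ` with `f(0) = 0` and `f(s(x)) = s(f(x))`. -/
def centralizer : AddSubgroup (D.X → Γ) where
  carrier := {f | f ⟨0, D.zero_mem⟩ = 0 ∧
    ∀ (s : AddAut Γ) (hs : s ∈ D.S) (x : D.X), f ⟨s x, D.map_mem s hs x x.2⟩ = s (f x)}
  zero_mem' := ⟨rfl, fun s _ _ => (map_zero s).symm⟩
  add_mem' := by
    rintro f g ⟨hf, hf'⟩ ⟨hg, hg'⟩
    refine ⟨by simp [hf, hg], fun s hs x => ?_⟩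
    simp only [Pi.add_apply, map_add, hf' s hs x, hg' s hs x]
  neg_mem' := by
    rintro f ⟨hf, hf'⟩
    refine ⟨by simp [hf], fun s hs x => ?_⟩
    simp only [Pi.neg_apply, map_neg, hf' s hs x]

/-- The sandwich centralizer near-ring `M₀(X, Γ, φ, S)`. -/
def M₀ : Type u := D.centralizer

namespace M₀

variable {D}

instance : CoeFun D.M₀ (fun _ => D.X → Γ) := ⟨fun f => f.1⟩

/-- Addition is pointwise, multiplication is the sandwich product `f ∘ φ ∘ g`. -/
instance : NearRing D.M₀ :=
  { (inferInstance : AddGroup D.centralizer) with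
    mul := fun f g => ⟨fun x => f.1 (D.φ (g.1 x)), by
      refine ⟨?_, fun s hs x => ?_⟩
      · have h : D.φ 0 = ⟨0, D.zero_mem⟩ := Subtype.ext D.φ_zero
        simp only [g.2.1, h, f.2.1]
      · have h : D.φ (s (g.1 x)) = ⟨s (D.φ (g.1 x)), D.map_mem s hs _ (D.φ (g.1 x)).2⟩ :=
          Subtype.ext (D.equivariant s hs _)
        simp only [g.2.2 s hs x, h, f.2.2 s hs]⟩
    mul_assoc := fun _ _ _ => rfl
    right_distrib := fun _ _ _ => rfl }

end M₀

/-- `F` is dense in `M₀(X, Γ, φ, S)`: on finitely many points of `X`, every element of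
`M₀(X, Γ, φ, S)` agrees with an element of `F`. -/
def IsDense (F : SubNearRing D.M₀) : Prop :=
  ∀ (n : ℕ) (x : Fin n → D.X) (g : D.M₀), ∃ f : F.Elem, ∀ i, f.1 (x i) = g (x i)

/-- `X₁ = X \ {0}`. -/
def X₁ : Set Γ := D.X \ {0}

/-- `S` acts without fixed points on `X₁`. -/
def IsFixedPointFree : Prop :=
  ∀ s ∈ D.S, ∀ x ∈ D.X₁, s x = x → s = AddEquiv.refl Γ

/-- The orbit `S(γ)`. -/
def orbit (γ : Γ) : Set Γ := {δ | ∃ s ∈ D.S, s γ = δ}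

/-- `Γ₀ = {γ | φ(γ) = 0}`. -/
def Γ₀ : Set Γ := {γ | (D.φ γ : Γ) = 0}

/-- The set `C` of the normal subgroups `I ⊆ Γ₀` of `Γ` such that `Γ₀` is the union of the cosets
`δ + I`, `δ ∈ Γ₀`, and `S(φ(γ + i)) = S(φ(γ))` for all `γ ∈ Γ \ Γ₀` and `i ∈ I`. -/
def C : Set (AddSubgroup Γ) :=
  {I | I.Normal ∧ (I : Set Γ) ⊆ D.Γ₀ ∧
    D.Γ₀ = ⋃ δ ∈ D.Γ₀, (fun i => δ + i) '' (I : Set Γ) ∧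
    ∀ γ ∉ D.Γ₀, ∀ i ∈ I, D.orbit (D.φ (γ + i)) = D.orbit (D.φ γ)}

/-- Property (P). -/
def PropertyP : Prop :=
  ∀ I ∈ D.C, I = ⊥ ∨
    ∃ i ∈ I, ∃ γ₁ ∉ D.Γ₀, ∃ s ∈ D.S, ∃ γ : Γ,
      (D.φ (γ₁ + i) : Γ) = s (D.φ γ₁) ∧ s γ - γ ∉ I

end SandwichData

/-!
A faithful `N`-group `Γ` of type `1` carries the group `S` of its `N`-automorphisms. Two generators
with the same annihilator differ by an element of `S` as far as the action of `N` can tell, and an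
element of `S` is determined by what it does to `N`-multiples of one generator. Hence the translates
under `S` of one chosen generator for each annihilator, together with `0`, form a set `X` such that
every `γ` acts (as `n ↦ n • γ`) like exactly one element of `X`. That element is `φ γ`; uniqueness
makes `φ` equivariant and the identity on `X`, and `n ↦ (x ↦ n • x)` embeds `N` into
`M₀(X, Γ, φ, S)`.

Density (`exists_smul_eqOn`) rests on `isRingNearRing_of_inf_smul_eq_zero`: if two left
ideals `D`, `B` satisfy `D x = B x = Γ` while `D ∩ B` annihilates `x`, then elements of `D x` and
`B x` commute and `N` acts additively on their sums, because both obstructions lie in `D ∩ B`; so a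
faithful `Γ` forces `N` to be a ring. For a non-ring, therefore, the common annihilator of finitely
many elements moves `x` through all of `Γ` as soon as none of their annihilators equals that of a
generator `x`.

Property (P) is simplicity of `Γ`. A member of `C` violating (P) is an `N`-ideal inside `Γ₀`, the
set of non-generators, so it is zero. Conversely, let `Γ` be acted on by a dense subnear-ring via
`n • γ = n (φ γ)`. Since `S` is free on `X₁`, elements of `M₀(X, Γ, φ, S)` can be prescribed on
orbit representatives in `X₁`; this makes every proper `N`-ideal a member of `C` for which the
second alternative of (P) is impossible.
-/

/-! ### Near-rings, left ideals and annihilators -/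

namespace NearRing

variable {N : Type u} [NearRing N]

/-- A left ideal: an `N`-ideal of the `N`-group `(N, +)`. -/
def IsLeftIdeal (D : AddSubgroup N) : Prop :=
  D.Normal ∧ ∀ n m : N, ∀ d ∈ D, n * (m + d) - n * m ∈ D

theorem IsLeftIdeal.inf {D B : AddSubgroup N} (hD : IsLeftIdeal D) (hB : IsLeftIdeal B) :
    IsLeftIdeal (D ⊓ B) :=
  ⟨⟨fun _ hd g => ⟨hD.1.conj_mem _ hd.1 g, hB.1.conj_mem _ hd.2 g⟩⟩,
    fun n m d hd => ⟨hD.2 n m d hd.1, hB.2 n m d hd.2⟩⟩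

theorem IsLeftIdeal.mul_mem {D : AddSubgroup N} (hD : IsLeftIdeal D) (hz : IsZeroSymmetric N)
    (n : N) {d : N} (hd : d ∈ D) : n * d ∈ D := by
  have h := hD.2 n 0 d hd
  rwa [zero_add, hz n, sub_zero] at h

end NearRing

namespace NGroup

open NearRing

variable {N : Type u} {Γ : Type v} [NearRing N] [AddGroup Γ] [NGroup N Γ]

protected theorem zero_smul (γ : Γ) : (0 : N) • γ = 0 := by
  have h := add_smul (0 : N) 0 γ
  rwa [add_zero, left_eq_add] at h

protected theorem neg_smul (n : N) (γ : Γ) : (-n) • γ = -(n • γ) := by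
  rw [eq_neg_iff_add_eq_zero, ← add_smul, neg_add_cancel, NGroup.zero_smul]

protected theorem sub_smul (m n : N) (γ : Γ) : (m - n) • γ = m • γ - n • γ := by
  rw [sub_eq_add_neg, add_smul, NGroup.neg_smul, sub_eq_add_neg]

protected theorem smul_zero (hz : IsZeroSymmetric N) (n : N) : n • (0 : Γ) = 0 := by
  rw [← NGroup.zero_smul (N := N) (0 : Γ), ← mul_smul, hz n]

theorem IsGenerator.exists_smul_eq {x : Γ} (hx : IsGenerator N x) (γ : Γ) :
    ∃ n : N, n • x = γ :=
  (Set.eq_univ_iff_forall.1 hx) γ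

theorem isGenerator_iff {x : Γ} : IsGenerator N x ↔ ∀ γ : Γ, ∃ n : N, n • x = γ :=
  Set.eq_univ_iff_forall

theorem not_isGenerator_of_forall_smul_eq_zero [Nontrivial Γ] {x : Γ}
    (h : ∀ n : N, n • x = 0) : ¬ IsGenerator N x := by
  intro hx
  obtain ⟨γ, hγ⟩ := exists_ne (0 : Γ)
  obtain ⟨n, hn⟩ := hx.exists_smul_eq γ
  exact hγ (hn ▸ h n)

theorem IsType1.smul_eq_zero (hΓ : IsType1 N Γ) {γ : Γ} (h : ¬ IsGenerator N γ) (n : N) :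
    n • γ = 0 := by
  have h1 := (hΓ.2 γ).resolve_left h
  have : n • γ ∈ Set.range (fun n : N => n • γ) := ⟨n, rfl⟩
  rw [h1] at this
  exact this

variable (N) in
/-- The annihilator `{n | n • y = 0 for all y ∈ Y}` of a subset `Y` of an `N`-group. -/
def annihilator (Y : Set Γ) : AddSubgroup N where
  carrier := {n | ∀ y ∈ Y, n • y = 0}
  zero_mem' := fun y _ => NGroup.zero_smul y
  add_mem' := fun {a b} ha hb y hy => by rw [add_smul, ha y hy, hb y hy, add_zero]
  neg_mem' := fun {a} ha y hy => by rw [NGroup.neg_smul, ha y hy, neg_zero]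

theorem mem_annihilator {Y : Set Γ} {n : N} : n ∈ annihilator N Y ↔ ∀ y ∈ Y, n • y = 0 :=
  Iff.rfl

theorem mem_annihilator_singleton {y : Γ} {n : N} : n ∈ annihilator N {y} ↔ n • y = 0 := by
  simp [mem_annihilator]

theorem annihilator_insert (y : Γ) (Y : Set Γ) :
    annihilator N (insert y Y) = annihilator N Y ⊓ annihilator N {y} := by
  ext n
  simp [mem_annihilator, and_comm]

theorem isLeftIdeal_annihilator (Y : Set Γ) : IsLeftIdeal (annihilator N Y) := by
  refine ⟨⟨fun d hd g y hy => ?_⟩, fun n m d hd y hy => ?_⟩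
  · rw [add_smul, add_smul, hd y hy, NGroup.neg_smul, add_zero, add_neg_cancel]
  · rw [NGroup.sub_smul, mul_smul, mul_smul, add_smul, hd y hy, add_zero, sub_self]

/-! ### The density theorem for `N`-groups of type `1` -/

/-- `D x` is an `N`-ideal when `x` is a generator and `D` a left ideal, so by simplicity it is all
of `Γ` as soon as it is nonzero. -/
theorem IsType1.smul_surjective_of_isLeftIdeal (hΓ : IsType1 N Γ) {x : Γ}
    (hx : IsGenerator N x) {D : AddSubgroup N} (hD : IsLeftIdeal D)
    (hne : ∃ d ∈ D, d • x ≠ 0) (γ : Γ) : ∃ d ∈ D, d • x = γ := by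
  let f : N →+ Γ := AddMonoidHom.mk' (fun n => n • x) fun a b => add_smul a b x
  have hI : IsIdeal N (D.map f) := by
    constructor
    · constructor
      rintro _ ⟨d, hd, rfl⟩ g
      obtain ⟨n, rfl⟩ := hx.exists_smul_eq g
      refine ⟨n + d + -n, hD.1.conj_mem _ hd n, ?_⟩
      rw [map_add, map_add, map_neg]
      rfl
    · rintro n g _ ⟨d, hd, rfl⟩
      obtain ⟨m, rfl⟩ := hx.exists_smul_eq g
      refine ⟨n * (m + d) - n * m, hD.2 n m d hd, ?_⟩
      change (n * (m + d) - n * m) • x = n • (m • x + d • x) - n • m • x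
      rw [NGroup.sub_smul, mul_smul, mul_smul, add_smul]
  rcases hΓ.1.2.1 _ hI with h | h
  · obtain ⟨d, hd, hne⟩ := hne
    have hmem : f d ∈ D.map f := ⟨d, hd, rfl⟩
    rw [h] at hmem
    exact absurd hmem hne
  · have hmem : γ ∈ D.map f := h ▸ AddSubgroup.mem_top γ
    obtain ⟨d, hd, h⟩ := hmem
    exact ⟨d, hd, h⟩

/-- The heart of the density theorem. The additive commutators of elements of `D` and `B`, and the
defects of distributivity `n * (d + b) - n * b - n * d`, lie in `D ⊓ B`; if this annihilates `x`,
then `N` acts on the abelian group `Γ` by endomorphisms. -/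
theorem isRingNearRing_of_inf_smul_eq_zero (hz : IsZeroSymmetric N) (hf : IsFaithful N Γ) {x : Γ}
    {D B : AddSubgroup N} (hD : IsLeftIdeal D) (hB : IsLeftIdeal B)
    (hDx : ∀ γ : Γ, ∃ d ∈ D, d • x = γ) (hBx : ∀ γ : Γ, ∃ b ∈ B, b • x = γ)
    (h : ∀ n ∈ D ⊓ B, n • x = 0) : IsRingNearRing N := by
  have hcomm (γ δ : Γ) : γ + δ = δ + γ := by
    obtain ⟨d, hd, rfl⟩ := hDx γ
    obtain ⟨b, hb, rfl⟩ := hBx δ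
    have hmem : (d + b) - (b + d) ∈ D ⊓ B := by
      constructor
      · have e : (d + b) - (b + d) = d + (b + -d + -b) := by
          simp only [sub_eq_add_neg, neg_add_rev, add_assoc]
        rw [e]
        exact D.add_mem hd (hD.1.conj_mem _ (D.neg_mem hd) b)
      · have e : (d + b) - (b + d) = (d + b + -d) + -b := by
          simp only [sub_eq_add_neg, neg_add_rev, add_assoc]
        rw [e]
        exact B.add_mem (hB.1.conj_mem _ hb d) (B.neg_mem hb)
    have h0 := h _ hmem
    rwa [NGroup.sub_smul, add_smul, add_smul, sub_eq_zero] at h0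
  have hdist (n : N) (γ δ : Γ) : n • (γ + δ) = n • γ + n • δ := by
    obtain ⟨d, hd, rfl⟩ := hDx γ
    obtain ⟨b, hb, rfl⟩ := hBx δ
    have hmem : n * (d + b) - n * b - n * d ∈ D ⊓ B := by
      constructor
      · have hd' : -b + d + b ∈ D := by
          simpa using hD.1.conj_mem _ hd (-b)
        have h1 := hD.2 n b _ hd'
        have e : b + (-b + d + b) = d + b := by
          rw [add_assoc, add_neg_cancel_left]
        rw [e] at h1
        exact D.sub_mem h1 (hD.mul_mem hz n hd)
      · have h1 := hB.2 n d b hb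
        have h2 := hB.1.conj_mem _ (B.neg_mem (hB.mul_mem hz n hb)) (n * d)
        have e : n * (d + b) - n * b - n * d =
            (n * (d + b) - n * d) + (n * d + -(n * b) + -(n * d)) := by
          simp only [sub_eq_add_neg, add_assoc, neg_add_cancel_left]
        rw [e]
        exact B.add_mem h1 h2
    have h0 := h _ hmem
    rwa [NGroup.sub_smul, NGroup.sub_smul, sub_eq_zero, sub_eq_iff_eq_add, mul_smul, mul_smul,
      mul_smul, add_smul] at h0
  have hext (a b : N) (hab : ∀ γ : Γ, a • γ = b • γ) : a = b := by
    have hmem : a - b ∈ {n : N | ∀ γ : Γ, n • γ = 0} := fun γ => by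
      rw [NGroup.sub_smul, hab, sub_self]
    rw [hf] at hmem
    exact sub_eq_zero.1 hmem
  refine ⟨fun a b => hext _ _ fun γ => ?_, fun a b c => hext _ _ fun γ => ?_⟩
  · rw [add_smul, add_smul, hcomm]
  · rw [mul_smul, add_smul, hdist, add_smul, mul_smul, mul_smul]

/-- An inclusion of annihilators of elements, into that of a generator, is an equality: otherwise
the larger one would move the smaller element through all of `Γ`, hence be all of `N`. -/
theorem IsType1.exists_smul_ne_zero_of_annihilator_ne (hΓ : IsType1 N Γ) {x y : Γ}
    (hx : IsGenerator N x) (hne : annihilator N {y} ≠ annihilator N {x}) :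
    ∃ n ∈ annihilator N {y}, n • x ≠ 0 := by
  have : Nontrivial Γ := hΓ.1.1
  by_contra! hall
  have hle : annihilator N {y} ≤ annihilator N {x} := fun n hn =>
    mem_annihilator_singleton.2 (hall n hn)
  by_cases hy : IsGenerator N y
  · have hne' : ∃ a ∈ annihilator N {x}, a • y ≠ 0 := by
      by_contra! hcon
      exact hne (le_antisymm hle fun n hn => mem_annihilator_singleton.2 (hcon n hn))
    refine not_isGenerator_of_forall_smul_eq_zero (N := N) (x := x) (fun n => ?_) hx
    obtain ⟨a, ha, hay⟩ :=
      hΓ.smul_surjective_of_isLeftIdeal hy (isLeftIdeal_annihilator {x}) hne' (n • y)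
    have h1 : n - a ∈ annihilator N {y} :=
      mem_annihilator_singleton.2 (by rw [NGroup.sub_smul, hay, sub_self])
    have h2 := hall _ h1
    rwa [NGroup.sub_smul, mem_annihilator_singleton.1 ha, sub_zero] at h2
  · exact not_isGenerator_of_forall_smul_eq_zero (N := N) (x := x)
      (fun n => hall n (mem_annihilator_singleton.2 (hΓ.smul_eq_zero hy n))) hx

theorem IsType1.exists_mem_annihilator_smul_eq (hz : IsZeroSymmetric N)
    (hring : ¬ IsRingNearRing N) (hΓ : IsType1 N Γ) (hf : IsFaithful N Γ) {x : Γ}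
    (hx : IsGenerator N x) {Y : Set Γ} (hY : Y.Finite)
    (hne : ∀ y ∈ Y, annihilator N {y} ≠ annihilator N {x}) (γ : Γ) :
    ∃ d ∈ annihilator N Y, d • x = γ := by
  induction Y, hY using Set.Finite.induction_on generalizing γ with
  | empty =>
    obtain ⟨n, hn⟩ := hx.exists_smul_eq γ
    exact ⟨n, fun y hy => absurd hy (Set.notMem_empty y), hn⟩
  | @insert y Y _ _ ih =>
    rw [annihilator_insert]
    refine hΓ.smul_surjective_of_isLeftIdeal hx
      ((isLeftIdeal_annihilator Y).inf (isLeftIdeal_annihilator {y})) ?_ γ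
    by_contra! hcon
    exact hring (isRingNearRing_of_inf_smul_eq_zero hz hf (isLeftIdeal_annihilator Y)
      (isLeftIdeal_annihilator {y}) (ih fun z hz => hne z (Set.mem_insert_of_mem y hz))
      (hΓ.smul_surjective_of_isLeftIdeal hx (isLeftIdeal_annihilator {y})
        (hΓ.exists_smul_ne_zero_of_annihilator_ne hx (hne y (Set.mem_insert y Y)))) hcon)

/-! ### Automorphisms of an `N`-group of type `1` -/

variable (N Γ) in
/-- The group of `N`-automorphisms of `Γ`. -/
def autGroup : AddSubgroup (AddAut Γ) where
  carrier := {s | ∀ (n : N) (γ : Γ), s (n • γ) = n • s γ}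
  zero_mem' := fun _ _ => rfl
  add_mem' := fun {s t} hs ht n γ => by
    rw [AddAut.add_apply, AddAut.add_apply, ht, hs]
  neg_mem' := fun {s} hs n γ => by
    apply s.injective
    rw [hs, AddAut.apply_neg_self, AddAut.apply_neg_self]

/-- Automorphisms are only determined through the action of `N`: as `N` need not have an identity,
the automorphism `n • x ↦ n • y` need not send `x` to `y`. -/
theorem exists_mem_autGroup_smul_eq {x y : Γ} (hx : IsGenerator N x) (hy : IsGenerator N y)
    (h : annihilator N {x} = annihilator N {y}) :
    ∃ s ∈ autGroup N Γ, ∀ n : N, s (n • x) = n • y := by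
  have key (m n : N) : m • x = n • x ↔ m • y = n • y := by
    rw [← sub_eq_zero, ← sub_eq_zero (a := m • y), ← NGroup.sub_smul, ← NGroup.sub_smul,
      ← mem_annihilator_singleton, ← mem_annihilator_singleton, h]
  choose f hf using hx.exists_smul_eq
  have hfy (n : N) : f (n • x) • y = n • y := (key _ _).1 (hf _)
  let s : Γ →+ Γ := AddMonoidHom.mk' (fun γ => f γ • y) fun a b => by
    rw [← add_smul, ← key, add_smul, hf, hf, hf]
  have hs : Function.Bijective s := by
    constructor
    · intro a b hab
      have := (key _ _).2 (show f a • y = f b • y from hab)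
      rwa [hf, hf] at this
    · intro γ
      obtain ⟨n, rfl⟩ := hy.exists_smul_eq γ
      exact ⟨n • x, hfy n⟩
  refine ⟨AddEquiv.ofBijective s hs, fun n γ => ?_, fun n => hfy n⟩
  change f (n • γ) • y = n • f γ • y
  rw [← mul_smul, ← key, mul_smul, hf, hf]

theorem IsGenerator.map {s : AddAut Γ} (hs : s ∈ autGroup N Γ) {x : Γ} (hx : IsGenerator N x) :
    IsGenerator N (s x) := by
  refine isGenerator_iff.2 fun γ => ?_
  obtain ⟨n, hn⟩ := hx.exists_smul_eq (s.symm γ)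
  exact ⟨n, by rw [← hs, hn, AddEquiv.apply_symm_apply]⟩

theorem annihilator_singleton_map {s : AddAut Γ} (hs : s ∈ autGroup N Γ) (x : Γ) :
    annihilator N {s x} = annihilator N {x} := by
  ext n
  rw [mem_annihilator_singleton, mem_annihilator_singleton, ← hs, map_eq_zero_iff _ s.injective]

theorem eq_of_forall_map_smul_eq {s t : AddAut Γ} {x : Γ} (hx : IsGenerator N x)
    (h : ∀ n : N, s (n • x) = t (n • x)) : s = t := by
  ext γ
  obtain ⟨n, rfl⟩ := hx.exists_smul_eq γ
  exact h n

/-- An invariant set of representatives for the relation "`n • γ = n • δ` for all `n`". On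
generators its elements are the translates of one generator for each annihilator. -/
theorem IsType1.exists_transversal (hz : IsZeroSymmetric N) (hΓ : IsType1 N Γ) :
    ∃ X : Set Γ, 0 ∈ X ∧ (∀ s ∈ autGroup N Γ, ∀ x ∈ X, s x ∈ X) ∧
      ∀ γ : Γ, ∃! x, x ∈ X ∧ ∀ n : N, n • x = n • γ := by
  have : Nontrivial Γ := hΓ.1.1
  have hrep (A : AddSubgroup N) : ∃ ρ : Γ, (∃ γ : Γ, IsGenerator N γ ∧ annihilator N {γ} = A) →
      IsGenerator N ρ ∧ annihilator N {ρ} = A := by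
    by_cases h : ∃ γ : Γ, IsGenerator N γ ∧ annihilator N {γ} = A
    · exact ⟨h.choose, fun _ => h.choose_spec⟩
    · exact ⟨0, fun h' => absurd h' h⟩
  choose ρ hρ using hrep
  have hgen {γ : Γ} (h : IsGenerator N γ) : IsGenerator N (ρ (annihilator N {γ})) ∧
      annihilator N {ρ (annihilator N {γ})} = annihilator N {γ} := hρ _ ⟨γ, h, rfl⟩
  have h0 : ¬ IsGenerator N (0 : Γ) :=
    not_isGenerator_of_forall_smul_eq_zero (NGroup.smul_zero hz)
  refine ⟨{x | x = 0 ∨ ∃ s ∈ autGroup N Γ, ∃ γ : Γ, IsGenerator N γ ∧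
    s (ρ (annihilator N {γ})) = x}, Or.inl rfl, ?_, fun γ => ?_⟩
  · rintro s hs x (rfl | ⟨t, ht, γ, hγ, rfl⟩)
    · exact Or.inl (map_zero s)
    · exact Or.inr ⟨s + t, add_mem hs ht, γ, hγ, rfl⟩
  · apply existsUnique_of_exists_of_unique
    · by_cases hγ : IsGenerator N γ
      · obtain ⟨s, hs, h⟩ := exists_mem_autGroup_smul_eq (hgen hγ).1 hγ (hgen hγ).2
        exact ⟨s (ρ (annihilator N {γ})), Or.inr ⟨s, hs, γ, hγ, rfl⟩, fun n => by rw [← hs, h]⟩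
      · exact ⟨0, Or.inl rfl, fun n => by rw [NGroup.smul_zero hz, hΓ.smul_eq_zero hγ]⟩
    · rintro x y ⟨hx, hxγ⟩ ⟨hy, hyγ⟩
      have hxy (n : N) : n • x = n • y := (hxγ n).trans (hyγ n).symm
      have hiff : IsGenerator N x ↔ IsGenerator N y := by
        simp only [isGenerator_iff, hxy]
      have hann : annihilator N {x} = annihilator N {y} := by
        ext n
        rw [mem_annihilator_singleton, mem_annihilator_singleton, hxy]
      rcases hx with rfl | ⟨s, hs, a, ha, rfl⟩ <;> rcases hy with rfl | ⟨t, ht, b, hb, rfl⟩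
      · rfl
      · exact absurd (hiff.2 ((hgen hb).1.map ht)) h0
      · exact absurd (hiff.1 ((hgen ha).1.map hs)) h0
      · rw [annihilator_singleton_map hs, annihilator_singleton_map ht, (hgen ha).2,
          (hgen hb).2] at hann
        rw [← hann] at hxy ⊢
        have hst : s = t := eq_of_forall_map_smul_eq (hgen ha).1 fun n => by
          rw [hs n, ht n, hxy n]
        rw [hst]

/-- The density theorem: functions on a transversal that commute with the automorphisms are
interpolated by elements of `N` at finitely many points. -/
theorem IsType1.exists_smul_eqOn (hz : IsZeroSymmetric N) (hring : ¬ IsRingNearRing N)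
    (hΓ : IsType1 N Γ) (hf : IsFaithful N Γ) {X : Set Γ}
    (hX : ∀ s ∈ autGroup N Γ, ∀ x ∈ X, s x ∈ X)
    (hu : ∀ γ : Γ, ∃! x, x ∈ X ∧ ∀ n : N, n • x = n • γ) {g : Γ → Γ} (hg0 : g 0 = 0)
    (hg : ∀ s ∈ autGroup N Γ, ∀ x ∈ X, g (s x) = s (g x)) (h0X : 0 ∈ X) {F : Set Γ} (hF : F.Finite)
    (hFX : F ⊆ X) : ∃ n : N, ∀ x ∈ F, n • x = g x := by
  have : Nontrivial Γ := hΓ.1.1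
  induction F, hF using Set.Finite.induction_on with
  | empty => exact ⟨0, fun x hx => absurd hx (Set.notMem_empty x)⟩
  | @insert x F _ hfin ih =>
    obtain ⟨n, hn⟩ := ih ((Set.subset_insert x F).trans hFX)
    have hxX : x ∈ X := hFX (Set.mem_insert x F)
    by_cases hx : IsGenerator N x
    · by_cases hex : ∃ y ∈ F, annihilator N {y} = annihilator N {x}
      · -- then `x` is a translate of `y`, and the value at `x` is determined by that at `y`
        obtain ⟨y, hyF, hyx⟩ := hex
        have hyX : y ∈ X := hFX (Set.mem_insert_of_mem x hyF)
        have hy : IsGenerator N y := by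
          by_contra hy
          refine not_isGenerator_of_forall_smul_eq_zero (fun m => ?_) hx
          rw [← mem_annihilator_singleton, ← hyx, mem_annihilator_singleton]
          exact hΓ.smul_eq_zero hy m
        obtain ⟨s, hs, hsy⟩ := exists_mem_autGroup_smul_eq hy hx hyx
        have hsx : s y = x := (hu x).unique
          ⟨hX s hs y hyX, fun m => by rw [← hs, hsy]⟩ ⟨hxX, fun _ => rfl⟩
        refine ⟨n, Set.forall_mem_insert.2 ⟨?_, hn⟩⟩
        rw [← hsx, ← hs, hn y hyF, hg s hs y hyX]
      · push Not at hex
        obtain ⟨d, hd, hdx⟩ := hΓ.exists_mem_annihilator_smul_eq hz hring hf hx hfin hex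
          (-(n • x) + g x)
        refine ⟨n + d, Set.forall_mem_insert.2 ⟨?_, fun y hy => ?_⟩⟩
        · rw [add_smul, hdx, add_neg_cancel_left]
        · rw [add_smul, hd y hy, add_zero, hn y hy]
    · have hx0 : x = 0 := (hu x).unique ⟨hxX, fun _ => rfl⟩
        ⟨h0X, fun m => by rw [NGroup.smul_zero hz, hΓ.smul_eq_zero hx]⟩
      refine ⟨n, Set.forall_mem_insert.2 ⟨?_, hn⟩⟩
      rw [hx0, NGroup.smul_zero hz, hg0]

end NGroup

/-! ### From an `N`-group of type `1` to a dense sandwich near-ring -/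

namespace SandwichData

variable {N : Type u} [NearRing N] {Γ : Type u} [AddGroup Γ] {D : SandwichData Γ}

theorem mem_orbit_self (γ : Γ) : γ ∈ D.orbit γ := ⟨0, D.S.zero_mem, rfl⟩

theorem orbit_map {s : AddAut Γ} (hs : s ∈ D.S) (γ : Γ) : D.orbit (s γ) = D.orbit γ := by
  ext δ
  constructor
  · rintro ⟨t, ht, rfl⟩
    exact ⟨t + s, add_mem ht hs, rfl⟩
  · rintro ⟨t, ht, rfl⟩
    exact ⟨t + -s, add_mem ht (neg_mem hs), by rw [AddAut.add_apply, AddAut.neg_apply_self]⟩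

theorem orbit_eq_of_mem {γ δ : Γ} (h : δ ∈ D.orbit γ) : D.orbit δ = D.orbit γ := by
  obtain ⟨s, hs, rfl⟩ := h
  exact orbit_map hs γ

section Action

variable [NGroup N Γ]

open NGroup

/-- The function `x ↦ n • x` as an element of `M₀(X, Γ, φ, S)`, where `S` consists of
`N`-automorphisms. -/
def ofSMul (hz : IsZeroSymmetric N) (hS : D.S ≤ autGroup N Γ) (n : N) : D.M₀ :=
  ⟨fun x => n • (x : Γ), NGroup.smul_zero hz n, fun _ hs x => (hS hs n x).symm⟩

/-- The image of `N` in `M₀(X, Γ, φ, S)`, where `φ` does not change the action of `N`. -/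
def smulRange (hz : IsZeroSymmetric N) (hS : D.S ≤ autGroup N Γ)
    (hφ : ∀ (n : N) (γ : Γ), n • (D.φ γ : Γ) = n • γ) : SubNearRing D.M₀ where
  carrier := Set.range (ofSMul hz hS)
  zero_mem' := ⟨0, Subtype.ext (funext fun x => NGroup.zero_smul (x : Γ))⟩
  add_mem' := by
    rintro _ _ ⟨m, rfl⟩ ⟨n, rfl⟩
    exact ⟨m + n, Subtype.ext (funext fun x => NGroup.add_smul m n (x : Γ))⟩
  neg_mem' := by
    rintro _ ⟨n, rfl⟩
    exact ⟨-n, Subtype.ext (funext fun x => NGroup.neg_smul n (x : Γ))⟩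
  mul_mem' := by
    rintro _ _ ⟨m, rfl⟩ ⟨n, rfl⟩
    refine ⟨m * n, Subtype.ext (funext fun x => ?_)⟩
    change (m * n) • (x : Γ) = m • (D.φ (n • (x : Γ)) : Γ)
    rw [hφ, NGroup.mul_smul]

theorem nonempty_ringEquiv_smulRange (hz : IsZeroSymmetric N) (hf : IsFaithful N Γ)
    (hS : D.S ≤ autGroup N Γ) (hφ : ∀ (n : N) (γ : Γ), n • (D.φ γ : Γ) = n • γ) :
    Nonempty (N ≃+* (smulRange hz hS hφ).Elem) := by
  let f : N → (smulRange hz hS hφ).Elem := fun n => ⟨ofSMul hz hS n, n, rfl⟩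
  have hinj : Function.Injective f := by
    intro m n h
    have hx (x : D.X) : m • (x : Γ) = n • (x : Γ) :=
      congrFun (congrArg Subtype.val (congrArg Subtype.val h)) x
    have hmem : m - n ∈ {n : N | ∀ γ : Γ, n • γ = 0} := fun γ => by
      rw [NGroup.sub_smul, ← hφ m, ← hφ n, hx, sub_self]
    rw [hf] at hmem
    exact sub_eq_zero.1 hmem
  have hsurj : Function.Surjective f := by
    rintro ⟨_, n, rfl⟩
    exact ⟨n, rfl⟩
  refine ⟨{ Equiv.ofBijective f ⟨hinj, hsurj⟩ with
    map_mul' := fun m n => Subtype.ext (Subtype.ext (funext fun x => ?_))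
    map_add' := fun m n => Subtype.ext (Subtype.ext (funext fun x => ?_)) }⟩
  · change (m * n) • (x : Γ) = m • (D.φ (n • (x : Γ)) : Γ)
    rw [hφ, NGroup.mul_smul]
  · exact NGroup.add_smul m n (x : Γ)

/-- If (P) fails for `I ∈ C`, then `n • (γ + i) - n • γ` has the form `s δ - δ` with `δ = n • γ`,
so `I` is an `N`-ideal; it lies in `Γ₀`, hence is proper. -/
theorem propertyP_of_isType1 (hz : IsZeroSymmetric N) (hΓ : IsType1 N Γ)
    (hS : D.S ≤ autGroup N Γ) (hφ : ∀ (n : N) (γ : Γ), n • (D.φ γ : Γ) = n • γ) :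
    D.PropertyP := by
  have : Nontrivial Γ := hΓ.1.1
  have hΓ₀ {γ : Γ} (h : γ ∈ D.Γ₀) (n : N) : n • γ = 0 := by
    rw [← hφ, show (D.φ γ : Γ) = 0 from h, NGroup.smul_zero hz]
  rintro I ⟨hnormal, hsub, hunion, horbit⟩
  by_contra! hcon
  obtain ⟨hne, hcon⟩ := hcon
  have hI : IsIdeal N I := by
    refine ⟨hnormal, fun n γ i hi => ?_⟩
    by_cases hγ : γ ∈ D.Γ₀
    · have hγi : γ + i ∈ D.Γ₀ := by
        rw [hunion]
        exact Set.mem_biUnion hγ ⟨i, hi, rfl⟩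
      rw [hΓ₀ hγ, hΓ₀ hγi, sub_zero]
      exact I.zero_mem
    · have hmem : (D.φ (γ + i) : Γ) ∈ D.orbit (D.φ γ) := by
        rw [← horbit γ hγ i hi]
        exact mem_orbit_self _
      obtain ⟨s, hs, hsγ⟩ := hmem
      rw [← hφ n (γ + i), ← hsγ, ← hS hs, hφ]
      exact hcon i hi γ hγ s hs (n • γ) hsγ.symm
  have htop := (hΓ.1.2.1 I hI).resolve_left hne
  obtain ⟨γ, hγ⟩ := hΓ.1.2.2
  refine not_isGenerator_of_forall_smul_eq_zero (hΓ₀ (hsub ?_)) hγ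
  rw [htop]
  exact AddSubgroup.mem_top γ

end Action

theorem exists_of_isType1 (hz : IsZeroSymmetric N) (hring : ¬ IsRingNearRing N) [NGroup N Γ]
    (hΓ : NGroup.IsType1 N Γ) (hf : NGroup.IsFaithful N Γ) :
    ∃ D : SandwichData Γ,
      D.X₁.Nonempty ∧ D.IsFixedPointFree ∧ (∀ x : D.X, D.φ x = x) ∧ D.PropertyP ∧
        ∃ M_S : SubNearRing D.M₀, D.IsDense M_S ∧ Nonempty (N ≃+* M_S.Elem) := by
  have : Nontrivial Γ := hΓ.1.1
  obtain ⟨X, h0, hX, hu⟩ := hΓ.exists_transversal hz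
  choose φ hφ hφu using hu
  have huniq (γ : Γ) : ∃! x, x ∈ X ∧ ∀ n : N, n • x = n • γ := ⟨φ γ, hφ γ, hφu γ⟩
  let D : SandwichData Γ :=
    { X := X
      zero_mem := h0
      φ := fun γ => ⟨φ γ, (hφ γ).1⟩
      φ_zero := (hφu 0 0 ⟨h0, fun _ => rfl⟩).symm
      S := NGroup.autGroup N Γ
      map_mem := hX
      equivariant := fun s hs γ => (hφu (s γ) (s (φ γ))
        ⟨hX s hs _ (hφ γ).1, fun n => by rw [← hs, (hφ γ).2, hs]⟩).symm }
  have hDφ (n : N) (γ : Γ) : n • (D.φ γ : Γ) = n • γ := (hφ γ).2 n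
  refine ⟨D, ?_, ?_, fun x => Subtype.ext (hφu x x ⟨x.2, fun _ => rfl⟩).symm,
    propertyP_of_isType1 hz hΓ le_rfl hDφ, smulRange hz le_rfl hDφ, ?_,
    nonempty_ringEquiv_smulRange hz hf le_rfl hDφ⟩
  · obtain ⟨γ, hγ⟩ := hΓ.1.2.2
    refine ⟨φ γ, (hφ γ).1, fun h => ?_⟩
    refine NGroup.not_isGenerator_of_forall_smul_eq_zero (fun n => ?_) hγ
    rw [← (hφ γ).2, show φ γ = 0 from h, NGroup.smul_zero hz]
  · rintro s hs x ⟨hx, hx0⟩ hsx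
    have hgen : NGroup.IsGenerator N x := by
      by_contra hgen
      exact hx0 ((huniq x).unique ⟨hx, fun _ => rfl⟩
        ⟨h0, fun n => by rw [NGroup.smul_zero hz, hΓ.smul_eq_zero hgen]⟩)
    refine NGroup.eq_of_forall_map_smul_eq hgen fun n => ?_
    rw [hs, hsx]
    rfl
  · intro l x g
    obtain ⟨n, hn⟩ := hΓ.exists_smul_eqOn hz hring hf hX huniq (g := fun γ => g (D.φ γ))
      (by
        have h : D.φ 0 = ⟨0, D.zero_mem⟩ := Subtype.ext D.φ_zero
        rw [h]
        exact g.2.1)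
      (fun s hs y _ => by
        have h : D.φ (s y) = ⟨s (D.φ y), D.map_mem s hs _ (D.φ y).2⟩ :=
          Subtype.ext (D.equivariant s hs y)
        rw [h]
        exact g.2.2 s hs _)
      h0 (Set.finite_range fun i => (x i : Γ)) (Set.range_subset_iff.2 fun i => (x i).2)
    refine ⟨⟨ofSMul hz le_rfl n, n, rfl⟩, fun i => ?_⟩
    have hx : D.φ (x i) = x i := Subtype.ext (hφu _ _ ⟨(x i).2, fun _ => rfl⟩).symm
    have h := hn _ ⟨i, rfl⟩
    rwa [hx] at h

/-! ### From a dense sandwich near-ring to an `N`-group of type `1` -/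

theorem IsFixedPointFree.eq_of_apply_eq (hfree : D.IsFixedPointFree) {x : Γ} (hx : x ∈ D.X₁)
    {s t : AddAut Γ} (hs : s ∈ D.S) (ht : t ∈ D.S) (h : s x = t x) : s = t := by
  have h1 := hfree (-t + s) (add_mem (neg_mem ht) hs) x hx (by
    rw [AddAut.add_apply, h, AddAut.neg_apply_self])
  exact (neg_add_eq_zero.1 h1).symm

/-- Elements of `M₀(X, Γ, φ, S)` take arbitrary values on a point of `X₁`, and may vanish off its
orbit. -/
theorem IsFixedPointFree.exists_apply_eq (hfree : D.IsFixedPointFree) (x : D.X)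
    (hx : (x : Γ) ≠ 0) (δ : Γ) :
    ∃ g : D.M₀, g x = δ ∧ ∀ y : D.X, (y : Γ) ∉ D.orbit x → g y = 0 := by
  classical
  have hx₁ : (x : Γ) ∈ D.X₁ := ⟨x.2, hx⟩
  let f : D.X → Γ := fun y => if h : (y : Γ) ∈ D.orbit x then h.choose δ else 0
  have hf (y : D.X) (s : AddAut Γ) (hs : s ∈ D.S) (h : s x = y) : f y = s δ := by
    have hy : (y : Γ) ∈ D.orbit x := ⟨s, hs, h⟩
    have hst := hfree.eq_of_apply_eq hx₁ hy.choose_spec.1 hs (hy.choose_spec.2.trans h.symm)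
    simp only [f, dif_pos hy, hst]
  have hf0 (y : D.X) (h : (y : Γ) ∉ D.orbit x) : f y = 0 := dif_neg h
  refine ⟨⟨f, hf0 _ ?_, fun s hs y => ?_⟩, hf x 0 D.S.zero_mem rfl, hf0⟩
  · rintro ⟨s, _, h⟩
    exact hx ((map_eq_zero_iff _ s.injective).1 h)
  · by_cases hy : (y : Γ) ∈ D.orbit x
    · obtain ⟨t, ht, hty⟩ := hy
      rw [hf y t ht hty]
      exact hf ⟨s y, D.map_mem s hs y y.2⟩ (s + t) (add_mem hs ht) (congrArg s hty)
    · rw [hf0 y hy, map_zero, hf0]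
      intro h
      apply hy
      rw [← orbit_eq_of_mem h, orbit_map hs]
      exact mem_orbit_self _

/-- A dense subnear-ring acts on `Γ` by `n • γ = n (φ γ)`. -/
theorem isOnePrimitive_of_isDense (hX₁ : D.X₁.Nonempty) (hfree : D.IsFixedPointFree)
    (hφ : ∀ x : D.X, D.φ x = x) (hP : D.PropertyP) {F : SubNearRing D.M₀} (hF : D.IsDense F)
    (e : N ≃+* F.Elem) : IsOnePrimitive N := by
  let _ : NGroup N Γ :=
    { smul := fun n γ => (e n).1 (D.φ γ)
      add_smul := fun m n γ => by
        change (e (m + n)).1 (D.φ γ) = (e m).1 (D.φ γ) + (e n).1 (D.φ γ)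
        rw [map_add]
        rfl
      mul_smul := fun m n γ => by
        change (e (m * n)).1 (D.φ γ) = (e m).1 (D.φ ((e n).1 (D.φ γ)))
        rw [map_mul]
        rfl }
  have hsmul (n : N) (γ : Γ) : n • γ = (e n).1 (D.φ γ) := rfl
  have hinterp (g : D.M₀) (γ δ : Γ) :
      ∃ n : N, n • γ = g (D.φ γ) ∧ n • δ = g (D.φ δ) := by
    obtain ⟨f, hf⟩ := hF 2 ![D.φ γ, D.φ δ] g
    refine ⟨e.symm f, ?_, ?_⟩
    · rw [hsmul, e.apply_symm_apply]
      exact hf 0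
    · rw [hsmul, e.apply_symm_apply]
      exact hf 1
  have hzero {γ : Γ} (hγ : γ ∈ D.Γ₀) (n : N) : n • γ = 0 := by
    have h : D.φ γ = ⟨0, D.zero_mem⟩ := Subtype.ext hγ
    rw [hsmul, h]
    exact (e n).1.2.1
  have hgen {γ : Γ} (hγ : γ ∉ D.Γ₀) (δ : Γ) : ∃ n : N, n • γ = δ := by
    obtain ⟨g, hg, _⟩ := hfree.exists_apply_eq (D.φ γ) hγ δ
    obtain ⟨n, hn, _⟩ := hinterp g γ γ
    exact ⟨n, hn.trans hg⟩
  have h0 : (0 : Γ) ∈ D.Γ₀ := D.φ_zero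
  obtain ⟨x, hx, hx0⟩ := hX₁
  have hxΓ₀ : x ∉ D.Γ₀ := fun h => hx0 ((congrArg Subtype.val (hφ ⟨x, hx⟩)).symm.trans h)
  refine ⟨Γ, inferInstance, inferInstance, ⟨⟨⟨x, 0, hx0⟩, fun I hI => ?_, x,
    NGroup.isGenerator_iff.2 (hgen hxΓ₀)⟩, fun γ => ?_⟩, ?_⟩
  · by_contra! hcon
    obtain ⟨hbot, htop⟩ := hcon
    have hsmulI (n : N) {i : Γ} (hi : i ∈ I) : n • i ∈ I := by
      have h := hI.2 n 0 i hi
      rwa [zero_add, hzero h0, sub_zero] at h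
    -- a proper `N`-ideal cannot contain `N γ` for a generator `γ`
    have hmem {γ : Γ} (h : ∀ n : N, n • γ ∈ I) : γ ∈ D.Γ₀ := by
      by_contra hγ
      refine htop ((AddSubgroup.eq_top_iff' I).2 fun δ => ?_)
      obtain ⟨n, rfl⟩ := hgen hγ δ
      exact h n
    have hadd {γ i : Γ} (hγ : γ ∈ D.Γ₀) (hi : i ∈ I) : γ + i ∈ D.Γ₀ := by
      refine hmem fun n => ?_
      have h := hI.2 n γ i hi
      rwa [hzero hγ, sub_zero] at h
    have hC : I ∈ D.C := by
      refine ⟨hI.1, fun i hi => hmem fun n => hsmulI n hi, ?_, fun γ hγ i hi => ?_⟩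
      · refine Set.Subset.antisymm (fun γ hγ => ?_) (Set.iUnion₂_subset fun δ hδ => ?_)
        · exact Set.mem_biUnion hγ ⟨0, I.zero_mem, add_zero γ⟩
        · rintro _ ⟨i, hi, rfl⟩
          exact hadd hδ hi
      · by_contra hne
        have hγi : γ + i ∉ D.Γ₀ := fun h => hγ (by simpa using hadd h (I.neg_mem hi))
        obtain ⟨δ, hδ⟩ : ∃ δ, δ ∉ I := by
          by_contra! hall
          exact htop ((AddSubgroup.eq_top_iff' I).2 hall)
        -- separate the two orbits by a function with values `δ` and `0`
        obtain ⟨g, hg, hg0⟩ := hfree.exists_apply_eq (D.φ (γ + i)) hγi δ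
        obtain ⟨n, hn1, hn2⟩ := hinterp g (γ + i) γ
        have h := hI.2 n γ i hi
        rw [hn1, hn2, hg, hg0 _ fun h => hne (orbit_eq_of_mem h).symm, sub_zero] at h
        exact hδ h
    obtain ⟨i, hi, γ₁, hγ₁, s, hs, γ, hs₁, hsγ⟩ := (hP I hC).resolve_left hbot
    obtain ⟨n, hn⟩ := hgen hγ₁ γ
    have h1 : n • (γ₁ + i) = s γ := by
      have h : D.φ (γ₁ + i) = ⟨s (D.φ γ₁), D.map_mem s hs _ (D.φ γ₁).2⟩ := Subtype.ext hs₁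
      rw [← hn, hsmul, hsmul, h]
      exact (e n).1.2.2 s hs _
    have h := hI.2 n γ₁ i hi
    rw [h1, hn] at h
    exact hsγ h
  · by_cases hγ : γ ∈ D.Γ₀
    · right
      ext δ
      simp [hzero hγ]
    · exact Or.inl (NGroup.isGenerator_iff.2 (hgen hγ))
  · refine Set.Subset.antisymm (fun n hn => ?_) ?_
    · apply e.injective
      rw [map_zero]
      refine Subtype.ext (Subtype.ext (funext fun y => ?_))
      have h := hn y
      rw [hsmul, hφ] at h
      exact h
    · rintro _ rfl γ
      exact NGroup.zero_smul γ

end SandwichData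

theorem theorem4p3 {N : Type u} [NearRing N] (hzero : IsZeroSymmetric N)
    (hring : ¬ IsRingNearRing N) :
    IsOnePrimitive N ↔
      ∃ (Γ : Type u) (_ : AddGroup Γ) (D : SandwichData Γ),
        D.X₁.Nonempty ∧ D.IsFixedPointFree ∧ (∀ x : D.X, D.φ x = x) ∧ D.PropertyP ∧
        ∃ M_S : SubNearRing D.M₀, D.IsDense M_S ∧ Nonempty (N ≃+* M_S.Elem) := by
  constructor
  · rintro ⟨Γ, _, _, hΓ, hf⟩
    exact ⟨Γ, _, SandwichData.exists_of_isType1 hzero hring hΓ hf⟩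
  · rintro ⟨Γ, _, D, hX₁, hfree, hφ, hP, F, hF, ⟨e⟩⟩
    exact SandwichData.isOnePrimitive_of_isDense hX₁ hfree hφ hP hF e
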